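/- Let $\Gamma$ be either a finite connected graph (multiple edges allowed, no loop edges) or a compact connected metric graph, of genus $g$ (its first Betti number), and let $v,w$ be points of $\Gamma$ (vertices, if $\Gamma$ is a finite graph). Divisors on $\Gamma$ are finite $\mathbb{Z}$-linear combinations of points, considered up to the usual linear equivalence, and $r(D)\ge -1$ denotes the Baker–Norine rank of a divisor $D$. A divisor $D$ is called submodular (with respect to $v,w$) if $r(D')-r(D'-v)-r(D'-w)+r(D'-v-w)\ge 0$ for all $D'=D+av-bw$ with $a,b\in\mathbb{Z}$. The transmission permutation of $D$, if it exists, is the unique permutation $\tau_D$ of $\mathbb{Z}$ such that for all $a,b\in\mathbb{Z}$ $$r(D+av-bw)+1=\#\{n\ge b:\ \tau_D(n)\le a\}.$$ An inversion of a permutation $\tau$ of $\mathbb{Z}$ is a pair $(m,n)\in\mathbb{Z}^2$ with $m<n$ and $\tau(m)>\tau(n)$. The triple $(\Gamma,v,w)$ has $0$-general transmission if every divisor $D$ on $\Gamma$ is submodular and its transmission permutation $\tau_D$ exists and has only finitely many, and in fact at most $g$, inversions. Theorem B. Suppose that $(\Gamma,v,w)$ has $0$-general transmission. Let $D$ be any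 divisor on $\Gamma$, of degree $d$ and rank $r=r(D)$, with vanishing sequences $(a_i)_{i=0}^r$ at $v$ and $(b_i)_{i=0}^r$ at $w$, i.e. $$a_i=\max\{a\in\mathbb{Z}:\ r(D-av)\ge r-i\},\qquad b_i=\max\{b\in\mathbb{Z}:\ r(D-bw)\ge r-i\}.$$ Then $$g-(r+1)(g-d+r)-\sum_{i=0}^r(a_i-i)-\sum_{i=0}^r(b_i-i)\ \ge\ 0.$$ -/

import Mathlib

open scoped Topology Classical

universe u

/-- A finite connected multigraph: finitely many vertices (at least one), finitely many edges,
possibly parallel edges and loops. Each edge carries an auxiliary reference orientation from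
`src` to `tgt`, which is only used to parametrise the edge. -/
structure ConnMultigraph : Type (u + 1) where
  V : Type u
  E : Type u
  finV : Fintype V
  finE : Fintype E
  src : E → V
  tgt : E → V
  nonempty : Nonempty V
  connected : ∀ x y : V, Relation.EqvGen (fun p q => ∃ e : E, src e = p ∧ tgt e = q) x y

attribute [instance] ConnMultigraph.finV ConnMultigraph.finE

/-- The genus (first Betti number) `|E| - |V| + 1`. -/
def ConnMultigraph.genus (G : ConnMultigraph.{u}) : ℤ :=
  (Fintype.card G.E : ℤ) - (Fintype.card G.V : ℤ) + 1

/-- A finite connected graph (parallel edges allowed) with no loop edges. -/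
structure FiniteGraph : Type (u + 1) extends ConnMultigraph.{u} where
  loopless : ∀ e : E, src e ≠ tgt e

/-- A compact connected metric graph, presented by a finite model: a finite connected multigraph
(loops allowed) in which every edge `e` is a segment of length `len e > 0`. -/
structure MetricGraph : Type (u + 1) extends ConnMultigraph.{u} where
  len : E → ℝ
  len_pos : ∀ e : E, 0 < len e

namespace FiniteGraph

/-- The Laplacian of an integer-valued function on the vertices: the effect on the number of chips
at `x` of the chip-firing move given by `f`. -/
noncomputable def laplacian (G : FiniteGraph.{u}) (f : G.V → ℤ) (x : G.V) : ℤ :=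
  (∑ e ∈ Finset.univ.filter (fun e : G.E => G.src e = x), (f (G.tgt e) - f x)) +
    ∑ e ∈ Finset.univ.filter (fun e : G.E => G.tgt e = x), (f (G.src e) - f x)

/-- A divisor is principal if it is the result of chip-firing moves from `0`. -/
def IsPrincipal (G : FiniteGraph.{u}) (D : G.V →₀ ℤ) : Prop :=
  ∃ f : G.V → ℤ, ∀ x : G.V, D x = G.laplacian f x

end FiniteGraph

/-- `φ` is affine with slope `s` immediately to the right of `t`. -/
def HasRightSlope (φ : ℝ → ℝ) (t : ℝ) (s : ℤ) : Prop :=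
  ∀ᶠ x in 𝓝[>] t, φ x = φ t + s * (x - t)

/-- Immediately to the left of `t`, `φ` is affine with slope `s` in the direction pointing away
from `t` (so `s` is minus the derivative there). -/
def HasLeftSlope (φ : ℝ → ℝ) (t : ℝ) (s : ℤ) : Prop :=
  ∀ᶠ x in 𝓝[<] t, φ x = φ t + s * (t - x)

namespace MetricGraph

/-- The points of a metric graph: the vertices of the model and the interior points of its edges,
the latter recorded by the distance to the source along the edge. -/
abbrev Point (Γ : MetricGraph.{u}) : Type u :=
  Γ.V ⊕ (Σ e : Γ.E, Set.Ioo (0 : ℝ) (Γ.len e))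

/-- The parametrisation `[0, len e] → Γ` of the edge `e` by arc length, from source to target
(constant outside this interval). -/
noncomputable def param (Γ : MetricGraph.{u}) (e : Γ.E) (t : ℝ) : Γ.Point :=
  if h : t ∈ Set.Ioo (0 : ℝ) (Γ.len e) then Sum.inr ⟨e, ⟨t, h⟩⟩
  else if t ≤ 0 then Sum.inl (Γ.src e) else Sum.inl (Γ.tgt e)

/-- `f : Γ → ℝ` is a rational function, that is, continuous and piecewise linear with integer
slopes, and at each point of each edge its outgoing slopes along that edge are given by
`R` (towards the target) and `L` (towards the source).
(Having such slopes at all points of the compact segment `[0, len e]` forces `f` to be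
continuous on it, with finitely many linear pieces.) -/
structure IsRationalWithSlopes (Γ : MetricGraph.{u}) (f : Γ.Point → ℝ)
    (R L : Γ.E → ℝ → ℤ) : Prop where
  right : ∀ e : Γ.E, ∀ t ∈ Set.Ico (0 : ℝ) (Γ.len e),
    HasRightSlope (fun x => f (Γ.param e x)) t (R e t)
  left : ∀ e : Γ.E, ∀ t ∈ Set.Ioc (0 : ℝ) (Γ.len e),
    HasLeftSlope (fun x => f (Γ.param e x)) t (L e t)

/-- A divisor is principal if it is the divisor of a rational function `f`: its coefficient at each
point is the sum of the outgoing slopes of `f` over all tangent directions there. -/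
def IsPrincipal (Γ : MetricGraph.{u}) (D : Γ.Point →₀ ℤ) : Prop :=
  ∃ (f : Γ.Point → ℝ) (R L : Γ.E → ℝ → ℤ), Γ.IsRationalWithSlopes f R L ∧
    (∀ x : Γ.V, D (Sum.inl x) =
      (∑ e ∈ Finset.univ.filter (fun e : Γ.E => Γ.src e = x), R e 0) +
        ∑ e ∈ Finset.univ.filter (fun e : Γ.E => Γ.tgt e = x), L e (Γ.len e)) ∧
    (∀ (e : Γ.E) (t : Set.Ioo (0 : ℝ) (Γ.len e)),
      D (Sum.inr ⟨e, t⟩) = R e (t : ℝ) + L e (t : ℝ))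

end MetricGraph

/-- A graph in the agnostic sense: either a finite graph or a metric graph. -/
inductive ChipGraph : Type (u + 1)
  | finite (G : FiniteGraph.{u}) : ChipGraph
  | metric (G : MetricGraph.{u}) : ChipGraph

namespace ChipGraph

/-- Points: the vertices of a finite graph, all points of a metric graph. -/
def Point : ChipGraph.{u} → Type u
  | finite G => G.V
  | metric G => G.Point

def genus : ChipGraph.{u} → ℤ
  | finite G => G.toConnMultigraph.genus
  | metric G => G.toConnMultigraph.genus

/-- Divisors: finite `ℤ`-linear combinations of points. -/
abbrev Div (Γ : ChipGraph.{u}) : Type u := Γ.Point →₀ ℤ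

def IsPrincipal : (Γ : ChipGraph.{u}) → Γ.Div → Prop
  | finite G => G.IsPrincipal
  | metric G => G.IsPrincipal

variable {Γ : ChipGraph.{u}}

/-- The point `p`, regarded as a divisor. -/
noncomputable def pt (p : Γ.Point) : Γ.Div := Finsupp.single p 1

/-- The degree of a divisor. -/
def deg (D : Γ.Div) : ℤ := D.sum fun _ n => n

/-- Effective divisors. -/
def IsEffective (D : Γ.Div) : Prop := ∀ p, 0 ≤ D p

/-- Linear equivalence of divisors. -/
def LinEquiv (D E : Γ.Div) : Prop := Γ.IsPrincipal (D - E)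

/-- The divisor `D` is linearly equivalent to an effective divisor. -/
def HasEffective (D : Γ.Div) : Prop := ∃ E : Γ.Div, IsEffective E ∧ LinEquiv D E

/-- The Baker–Norine rank: the largest integer `k ≥ -1` such that `D - E` is equivalent to an
effective divisor for every effective `E` of degree `k` (for `k = -1` there is no such `E`). -/
noncomputable def rank (D : Γ.Div) : ℤ :=
  sSup {k : ℤ | -1 ≤ k ∧ ∀ E : Γ.Div, IsEffective E → deg E = k → HasEffective (D - E)}

/-- The twist `D + a v - b w`. -/
noncomputable def twist (v w : Γ.Point) (D : Γ.Div) (a b : ℤ) : Γ.Div :=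
  D + a • pt v - b • pt w

/-- `D` is submodular with respect to `v, w`:
`r(D') - r(D' - v) - r(D' - w) + r(D' - v - w) ≥ 0` for all twists `D' = D + a v - b w`. -/
def IsSubmodular (v w : Γ.Point) (D : Γ.Div) : Prop :=
  ∀ a b : ℤ,
    0 ≤ rank (twist v w D a b) - rank (twist v w D a b - pt v)
      - rank (twist v w D a b - pt w) + rank (twist v w D a b - pt v - pt w)

/-- `τ` is the transmission permutation of `D`: for all integers `a, b`,
`r(D + a v - b w) + 1 = #{n ≥ b : τ n ≤ a}` (in particular these sets are finite).
By Riemann–Roch this is equivalent to the dual condition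
`r(K - D - a v + b w) + 1 = #{n < b : τ n > a}` for all `a, b`. -/
def IsTransmissionPerm (v w : Γ.Point) (D : Γ.Div) (τ : Equiv.Perm ℤ) : Prop :=
  ∀ a b : ℤ, {n : ℤ | b ≤ n ∧ τ n ≤ a}.Finite ∧
    rank (twist v w D a b) + 1 = ({n : ℤ | b ≤ n ∧ τ n ≤ a}.ncard : ℤ)

end ChipGraph

/-- The inversions of a permutation of `ℤ`. -/
def inversions (τ : Equiv.Perm ℤ) : Set (ℤ × ℤ) := {p | p.1 < p.2 ∧ τ p.2 < τ p.1}

namespace ChipGraph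

variable {Γ : ChipGraph.{u}}

/-- `(Γ, v, w)` has `0`-general transmission: every divisor is submodular, and its transmission
permutation has finitely many inversions, in fact at most `g` of them. -/
def HasZeroGeneralTransmission (v w : Γ.Point) : Prop :=
  ∀ D : Γ.Div, IsSubmodular v w D ∧
    ∃ τ : Equiv.Perm ℤ, IsTransmissionPerm v w D τ ∧
      (inversions τ).Finite ∧ ((inversions τ).ncard : ℤ) ≤ Γ.genus

/-- The terms `max {a ∈ ℤ : r(D - a u) ≥ r(D) - i}`, `0 ≤ i ≤ r(D)`, of the vanishing sequence
of `D` at `u`. -/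
noncomputable def vanishing (D : Γ.Div) (u : Γ.Point) (i : ℕ) : ℤ :=
  sSup {a : ℤ | rank D - (i : ℤ) ≤ rank (D - a • pt u)}

end ChipGraph

/-! The number of inversions of `τ = τ_D` bounds the sum of both vanishing sequences. Let `S = {n ≥
0 : τ n ≤ 0}`, so `#S = r + 1`. The `b_i` are the elements of `S` and the `a_i` are the values `-τ
n` on `S`, so `∑ a_i + ∑ b_i = ∑_{n ∈ S} (n - τ n)`. Subtracting the two sums of indices, and using
that `τ` has at most `g` inversions, it suffices that each `n` is the second entry of at least `n -
τ n + g - d` inversions (`le_card_inversions_snd_eq`).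

For that, take `A` large. There are `A - τ n + 1` integers whose `τ`-value lies in `[τ n, A]`; those
at or beyond `n` number at most `r(D + Av - nw) + 1`, and each of the others forms an inversion with
`n`. So all that is needed is `r ≤ deg - g` for `D + Av - nw` with `A` large, half of Riemann–Roch
(`exists_rank_twist_le`). It follows from the existence of a divisor `ν` of degree `g - 1` with no
effective representative: the transmission permutation of `D - ν` shows that `D + Av - nw - ν` is
equivalent to an effective divisor once `A` is large, and this caps the rank
(`rank_le_of_hasEffective_sub`). The divisor `ν` is written down explicitly on finite and on metric
graphs, and a minimum principle shows that it works. -/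

/-! ### Piecewise linear functions on a segment. -/

/-- Points just to the right of `t` lie inside an open interval on which `φ` is affine, so there is
no bend at them. -/
theorem HasRightSlope.eventually_slopes {φ : ℝ → ℝ} {t : ℝ} {s : ℤ} (h : HasRightSlope φ t s) :
    ∀ᶠ x in 𝓝[>] t, HasRightSlope φ x s ∧ HasLeftSlope φ x (-s) := by
  unfold HasRightSlope at h
  filter_upwards [eventually_eventually_nhdsWithin.2 h, h, self_mem_nhdsWithin] with x hx hxt htx
  rw [isOpen_Ioi.nhdsWithin_eq htx] at hx
  refine ⟨?_, ?_⟩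
  · filter_upwards [mem_nhdsWithin_of_mem_nhds hx] with y hy
    rw [hy, hxt]; ring
  · filter_upwards [mem_nhdsWithin_of_mem_nhds hx] with y hy
    rw [hy, hxt]; push_cast; ring

theorem HasLeftSlope.eventually_slopes {φ : ℝ → ℝ} {t : ℝ} {s : ℤ} (h : HasLeftSlope φ t s) :
    ∀ᶠ x in 𝓝[<] t, HasRightSlope φ x (-s) ∧ HasLeftSlope φ x s := by
  unfold HasLeftSlope at h
  filter_upwards [eventually_eventually_nhdsWithin.2 h, h, self_mem_nhdsWithin] with x hx hxt htx
  rw [isOpen_Iio.nhdsWithin_eq htx] at hx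
  refine ⟨?_, ?_⟩
  · filter_upwards [mem_nhdsWithin_of_mem_nhds hx] with y hy
    rw [hy, hxt]; push_cast; ring
  · filter_upwards [mem_nhdsWithin_of_mem_nhds hx] with y hy
    rw [hy, hxt]; ring

theorem HasRightSlope.unique {φ : ℝ → ℝ} {t : ℝ} {s s' : ℤ} (h : HasRightSlope φ t s)
    (h' : HasRightSlope φ t s') : s = s' := by
  unfold HasRightSlope at h h'
  obtain ⟨x, hx, hx', htx⟩ := (h.and (h'.and self_mem_nhdsWithin)).exists
  have h0 : x - t ≠ 0 := sub_ne_zero.2 (ne_of_gt htx)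
  have : (s : ℝ) = s' := mul_right_cancel₀ h0 (by linarith)
  exact_mod_cast this

theorem HasRightSlope.continuousWithinAt {φ : ℝ → ℝ} {t : ℝ} {s : ℤ} (h : HasRightSlope φ t s) :
    ContinuousWithinAt φ (Set.Ioi t) t := by
  have hc : ContinuousWithinAt (fun x => φ t + s * (x - t)) (Set.Ioi t) t := by fun_prop
  exact hc.congr_of_eventuallyEq h (by simp)

theorem HasLeftSlope.continuousWithinAt {φ : ℝ → ℝ} {t : ℝ} {s : ℤ} (h : HasLeftSlope φ t s) :
    ContinuousWithinAt φ (Set.Iio t) t := by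
  have hc : ContinuousWithinAt (fun x => φ t + s * (t - x)) (Set.Iio t) t := by fun_prop
  exact hc.congr_of_eventuallyEq h (by simp)

theorem eventually_nhdsWithin_Icc {l t : ℝ} (ht : t ∈ Set.Icc 0 l) {p : ℝ → Prop} (h : p t)
    (hr : t < l → ∀ᶠ x in 𝓝[>] t, p x) (hl : 0 < t → ∀ᶠ x in 𝓝[<] t, p x) :
    ∀ᶠ x in 𝓝[Set.Icc 0 l] t, p x := by
  have hr' : ∀ᶠ x in 𝓝[>] t, x ≤ l → p x := by
    rcases ht.2.lt_or_eq with h1 | h1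
    · exact (hr h1).mono fun x hx _ => hx
    · filter_upwards [self_mem_nhdsWithin] with x hx hxl
      exact absurd (h1 ▸ hxl) (not_le.2 hx)
  have hl' : ∀ᶠ x in 𝓝[<] t, 0 ≤ x → p x := by
    rcases ht.1.lt_or_eq with h1 | h1
    · exact (hl h1).mono fun x hx _ => hx
    · filter_upwards [self_mem_nhdsWithin] with x hx hxl
      exact absurd (h1 ▸ hxl) (not_le.2 hx)
  rw [eventually_nhdsWithin_iff] at hr' hl' ⊢
  filter_upwards [hr', hl'] with x h1 h2 h3
  rcases lt_trichotomy x t with h4 | h4 | h4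
  · exact h2 h4 h3.1
  · exact h4 ▸ h
  · exact h1 h4 h3.2

section Segment

variable {φ : ℝ → ℝ} {l : ℝ} {R L : ℝ → ℤ}

theorem continuousOn_of_slopes (hR : ∀ t ∈ Set.Ico 0 l, HasRightSlope φ t (R t))
    (hL : ∀ t ∈ Set.Ioc 0 l, HasLeftSlope φ t (L t)) : ContinuousOn φ (Set.Icc 0 l) := by
  intro t ht
  refine fun U hU => eventually_nhdsWithin_Icc ht (mem_of_mem_nhds hU) (fun h => ?_) (fun h => ?_)
  · exact (hR t ⟨ht.1, h⟩).continuousWithinAt hU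
  · exact (hL t ⟨h, ht.2⟩).continuousWithinAt hU

/-- The total of the outgoing slopes of a piecewise linear function on a segment vanishes. -/
theorem sum_slopes_eq_zero (hl : 0 < l) (hR : ∀ t ∈ Set.Ico 0 l, HasRightSlope φ t (R t))
    (hL : ∀ t ∈ Set.Ioc 0 l, HasLeftSlope φ t (L t)) (S : Finset (Set.Ioo (0 : ℝ) l))
    (hS : ∀ t : Set.Ioo (0 : ℝ) l, t ∉ S → R t + L t = 0) :
    R 0 + L l + ∑ t ∈ S, (R t + L t) = 0 := by
  -- `H` is the right slope with all bends up to `t` subtracted, hence locally constant. At `l`,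
  -- where no right slope is given, `-L l` (the derivative from the left) takes its place. Comparing
  -- `H 0` with `H l` gives the claim.
  set H : ℝ → ℤ := fun t => (if t < l then R t else -L l) -
    ∑ s ∈ S.filter (fun s : Set.Ioo (0 : ℝ) l => (s : ℝ) ≤ t), (R s + L s) with hH
  have key : ∀ t ∈ Set.Icc 0 l, ∀ᶠ x in 𝓝[Set.Icc 0 l] t, H x = H t := by
    intro t ht
    refine eventually_nhdsWithin_Icc ht rfl (fun h => ?_) (fun h => ?_)
    · have h1 : ∀ᶠ x in 𝓝[>] t, ∀ s : Set.Ioo (0 : ℝ) l, s ∈ S → t < (s : ℝ) → x < (s : ℝ) := by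
        refine (Filter.eventually_all_finset S).2 ?_
        intro s _
        by_cases hs : t < (s : ℝ)
        · exact ((eventually_lt_nhds hs).filter_mono nhdsWithin_le_nhds).mono fun x hx _ => hx
        · exact Filter.Eventually.of_forall fun x hx => absurd hx hs
      filter_upwards [h1, (hR t ⟨ht.1, h⟩).eventually_slopes, self_mem_nhdsWithin,
        mem_nhdsWithin_of_mem_nhds (Iio_mem_nhds h)] with x hx1 hx2 hx3 hx4
      have e1 : R x = R t := (hR x ⟨ht.1.trans (le_of_lt hx3), hx4⟩).unique hx2.1
      have e2 : S.filter (fun s : Set.Ioo (0 : ℝ) l => (s : ℝ) ≤ x) = S.filter (fun s : Set.Ioo (0 : ℝ) l => (s : ℝ) ≤ t) := by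
        refine Finset.filter_congr fun s hs => ⟨fun h5 => ?_, fun h5 => h5.trans (le_of_lt hx3)⟩
        by_contra h6
        exact absurd (hx1 s hs (not_le.1 h6)) (not_lt.2 h5)
      have hx4' : x < l := hx4
      simp only [hH, e2, if_pos hx4', if_pos h, e1]
    · have h1 : ∀ᶠ x in 𝓝[<] t, ∀ s : Set.Ioo (0 : ℝ) l, s ∈ S → (s : ℝ) < t → (s : ℝ) < x := by
        refine (Filter.eventually_all_finset S).2 ?_
        intro s _
        by_cases hs : (s : ℝ) < t
        · exact ((eventually_gt_nhds hs).filter_mono nhdsWithin_le_nhds).mono fun x hx _ => hx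
        · exact Filter.Eventually.of_forall fun x hx => absurd hx hs
      filter_upwards [h1, (hL t ⟨h, ht.2⟩).eventually_slopes, self_mem_nhdsWithin,
        mem_nhdsWithin_of_mem_nhds (Ioi_mem_nhds h)] with x hx1 hx2 hx3 hx4
      have hxt : x < t := hx3
      have hx0 : 0 < x := hx4
      have hxl : x < l := hxt.trans_le ht.2
      have e1 : R x = -L t := (hR x ⟨hx0.le, hxl⟩).unique hx2.1
      have e2 : S.filter (fun s : Set.Ioo (0 : ℝ) l => (s : ℝ) ≤ x) = S.filter (fun s : Set.Ioo (0 : ℝ) l => (s : ℝ) < t) := by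
        refine Finset.filter_congr fun s hs => ⟨fun h5 => h5.trans_lt hxt, fun h5 => ?_⟩
        exact (hx1 s hs h5).le
      -- The bend at `t` itself enters the sum exactly when `t` is interior; if `t ∉ S` it is zero
      -- by `hS`.
      have e3 : ∑ s ∈ S.filter (fun s : Set.Ioo (0 : ℝ) l => (s : ℝ) ≤ t), (R s + L s) =
          ∑ s ∈ S.filter (fun s : Set.Ioo (0 : ℝ) l => (s : ℝ) < t), (R s + L s) + if t < l then R t + L t else 0 := by
        have : S.filter (fun s : Set.Ioo (0 : ℝ) l => (s : ℝ) ≤ t) =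
            S.filter (fun s : Set.Ioo (0 : ℝ) l => (s : ℝ) < t) ∪ S.filter (fun s : Set.Ioo (0 : ℝ) l => (s : ℝ) = t) := by
          rw [← Finset.filter_or]
          exact Finset.filter_congr fun s _ => le_iff_lt_or_eq
        rw [this, Finset.sum_union]
        · congr 1
          split_ifs with htl
          · by_cases hm : (⟨t, h, htl⟩ : Set.Ioo (0 : ℝ) l) ∈ S
            · have : S.filter (fun s : Set.Ioo (0 : ℝ) l => (s : ℝ) = t) = {⟨t, h, htl⟩} := by
                ext s
                simp only [Finset.mem_filter, Finset.mem_singleton, Subtype.ext_iff]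
                exact ⟨fun h => h.2, fun h => ⟨by convert hm; exact Subtype.ext h, h⟩⟩
              rw [this, Finset.sum_singleton]
            · have : S.filter (fun s : Set.Ioo (0 : ℝ) l => (s : ℝ) = t) = ∅ := by
                refine Finset.filter_eq_empty_iff.2 fun s hs hst => hm ?_
                convert hs
                exact Subtype.ext hst.symm
              rw [this, Finset.sum_empty]
              exact (hS ⟨t, h, htl⟩ hm).symm
          · refine Finset.sum_eq_zero fun s hs => absurd ?_ htl
            rw [← (Finset.mem_filter.1 hs).2]
            exact s.2.2
        · refine Finset.disjoint_filter.2 fun s _ h5 h6 => absurd h6 h5.ne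
      simp only [hH, e2, e3, if_pos hxl, e1]
      split_ifs with htl
      · ring
      · rw [le_antisymm ht.2 (not_lt.1 htl)]; ring
  have hc : ContinuousOn H (Set.Icc 0 l) := fun t ht =>
    tendsto_const_nhds.congr' ((key t ht).mono fun x hx => hx.symm)
  have h0 := isPreconnected_Icc.constant hc (Set.left_mem_Icc.2 hl.le) (Set.right_mem_Icc.2 hl.le)
  have e1 : S.filter (fun s : Set.Ioo (0 : ℝ) l => (s : ℝ) ≤ 0) = ∅ :=
    Finset.filter_eq_empty_iff.2 fun s _ => not_le.2 s.2.1
  have e2 : S.filter (fun s : Set.Ioo (0 : ℝ) l => (s : ℝ) ≤ l) = S :=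
    Finset.filter_true_of_mem fun s _ => s.2.2.le
  simp only [hH, e1, e2, if_pos hl, lt_irrefl, if_false, Finset.sum_empty] at h0
  linarith

/-- A piecewise linear function on a segment that is concave up to a bend of at most `1` at a single
interior point attains its minimum at an end point. -/
theorem min_endpoints_le (hR : ∀ t ∈ Set.Ico 0 l, HasRightSlope φ t (R t))
    (hL : ∀ t ∈ Set.Ioc 0 l, HasLeftSlope φ t (L t)) (c : ℝ)
    (hc : ∀ t ∈ Set.Ioo 0 l, t ≠ c → R t + L t ≤ 0)
    (hc' : ∀ t ∈ Set.Ioo 0 l, R t + L t ≤ 1) {t : ℝ} (ht : t ∈ Set.Icc 0 l) :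
    min (φ 0) (φ l) ≤ φ t := by
  by_contra hlt
  have hcont := continuousOn_of_slopes hR hL
  obtain ⟨m, hm, hmin⟩ := isCompact_Icc.exists_isMinOn ⟨t, ht⟩ hcont
  have hlt' : φ m < min (φ 0) (φ l) := (hmin ht).trans_lt (not_le.1 hlt)
  -- If the claim fails, all minimizers are interior. Slopes being integers, the leftmost one has
  -- left slope at least `1` and the rightmost one right slope at least `1`. Both then bend upwards,
  -- so both equal `c`, where the bend is at least `2`.
  set K := Set.Icc 0 l ∩ φ ⁻¹' {φ m}
  have hK : IsCompact K := isCompact_Icc.of_isClosed_subset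
    (hcont.preimage_isClosed_of_isClosed isClosed_Icc isClosed_singleton) Set.inter_subset_left
  have hKn : K.Nonempty := ⟨m, hm, rfl⟩
  have hKI : ∀ x ∈ K, x ∈ Set.Ioo 0 l := by
    intro x hx
    refine ⟨hx.1.1.lt_of_ne ?_, hx.1.2.lt_of_ne ?_⟩
    · rintro rfl
      exact (hlt'.trans_le (min_le_left _ _)).ne' hx.2
    · rintro rfl
      exact (hlt'.trans_le (min_le_right _ _)).ne' hx.2
  have hRn : ∀ x ∈ K, 0 ≤ R x ∧ ((∀ y ∈ K, y ≤ x) → 1 ≤ R x) := by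
    intro x hx
    have hxI := hKI x hx
    have h1 := hR x ⟨hxI.1.le, hxI.2⟩
    unfold HasRightSlope at h1
    obtain ⟨y, hy, hxy, hyl⟩ := (h1.and (eventually_mem_nhdsWithin.and
      ((eventually_lt_nhds hxI.2).filter_mono nhdsWithin_le_nhds))).exists
    have hxy' : x < y := hxy
    have hyl' : y < l := hyl
    have hyI : y ∈ Set.Icc 0 l := ⟨(hxI.1.trans hxy').le, hyl'.le⟩
    have h2 : φ m ≤ φ y := hmin hyI
    have hx2 : φ x = φ m := hx.2
    have h3 : (0 : ℝ) ≤ R x := by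
      by_contra h4
      nlinarith [mul_pos_of_neg_of_neg (not_le.1 h4) (sub_neg.2 hxy')]
    have h3' : 0 ≤ R x := by exact_mod_cast h3
    refine ⟨h3', fun hgr => ?_⟩
    rcases h3'.lt_or_eq with h4 | h4
    · exact h4
    · rw [← h4] at hy
      exact absurd (hgr y ⟨hyI, by simp [hy, hx2]⟩) (not_le.2 hxy')
  have hLn : ∀ x ∈ K, 0 ≤ L x ∧ ((∀ y ∈ K, x ≤ y) → 1 ≤ L x) := by
    intro x hx
    have hxI := hKI x hx
    have h1 := hL x ⟨hxI.1, hxI.2.le⟩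
    unfold HasLeftSlope at h1
    obtain ⟨y, hy, hxy, hyl⟩ := (h1.and (eventually_mem_nhdsWithin.and
      ((eventually_gt_nhds hxI.1).filter_mono nhdsWithin_le_nhds))).exists
    have hxy' : y < x := hxy
    have hyl' : 0 < y := hyl
    have hyI : y ∈ Set.Icc 0 l := ⟨hyl'.le, (hxy'.trans hxI.2).le⟩
    have h2 : φ m ≤ φ y := hmin hyI
    have hx2 : φ x = φ m := hx.2
    have h3 : (0 : ℝ) ≤ L x := by
      by_contra h4
      nlinarith [mul_pos_of_neg_of_neg (not_le.1 h4) (sub_neg.2 hxy')]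
    have h3' : 0 ≤ L x := by exact_mod_cast h3
    refine ⟨h3', fun hgr => ?_⟩
    rcases h3'.lt_or_eq with h4 | h4
    · exact h4
    · rw [← h4] at hy
      exact absurd (hgr y ⟨hyI, by simp [hy, hx2]⟩) (not_le.2 hxy')
  obtain ⟨p, hp, hpl⟩ := hK.exists_isLeast hKn
  obtain ⟨q, hq, hqg⟩ := hK.exists_isGreatest hKn
  have hpL := (hLn p hp).2 fun y hy => hpl hy
  have hqR := (hRn q hq).2 fun y hy => hqg hy
  have hpc : p = c := by
    by_contra h
    have := hc p (hKI p hp) h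
    have := (hRn p hp).1
    omega
  have hqc : q = c := by
    by_contra h
    have := hc q (hKI q hq) h
    have := (hLn q hq).1
    omega
  have h1 := hc' p (hKI p hp)
  rw [hpc] at hpL h1
  rw [hqc] at hqR
  omega

end Segment

/-! ### Finite graphs: principal divisors and a divisor without effective representative. -/

theorem sum_sum_fiber {V E : Type*} [Fintype V] [Fintype E] (g : E → V) (F : E → ℤ) :
    ∑ x, ∑ e ∈ Finset.univ.filter (fun e => g e = x), F e = ∑ e, F e :=
  Finset.sum_fiberwise _ _ _

namespace FiniteGraph

variable (G : FiniteGraph.{u})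

theorem sum_laplacian (f : G.V → ℤ) : ∑ x, G.laplacian f x = 0 := by
  have h1 : ∀ x, G.laplacian f x =
      (∑ e ∈ Finset.univ.filter (fun e : G.E => G.src e = x), (f (G.tgt e) - f (G.src e))) +
      ∑ e ∈ Finset.univ.filter (fun e : G.E => G.tgt e = x), (f (G.src e) - f (G.tgt e)) := by
    intro x
    unfold laplacian
    congr 1 <;> exact Finset.sum_congr rfl fun e he => by rw [(Finset.mem_filter.1 he).2]
  simp_rw [h1]
  rw [Finset.sum_add_distrib, sum_sum_fiber, sum_sum_fiber,
    ← Finset.sum_add_distrib]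
  exact Finset.sum_eq_zero fun e _ => by ring

theorem degree_eq_zero_of_isPrincipal {D : G.V →₀ ℤ} (hD : G.IsPrincipal D) : D.degree = 0 := by
  obtain ⟨f, hf⟩ := hD
  rw [Finsupp.degree_eq_sum, ← G.sum_laplacian f]
  exact Finset.sum_congr rfl fun x _ => hf x

theorem laplacian_sub (f f' : G.V → ℤ) (x : G.V) :
    G.laplacian (fun y => f y - f' y) x = G.laplacian f x - G.laplacian f' x := by
  unfold laplacian
  rw [add_sub_add_comm, ← Finset.sum_sub_distrib, ← Finset.sum_sub_distrib]
  congr 1 <;> exact Finset.sum_congr rfl fun e _ => by ring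

/-- Number the vertices and let `ν x` be the number of edges from `x` to lower-numbered vertices,
minus one. Each edge is counted once, so the degree is `|E| - |V|`. -/
theorem exists_noneffective : ∃ ν : G.V →₀ ℤ, ν.degree = G.toConnMultigraph.genus - 1 ∧
    ∀ E : G.V →₀ ℤ, (∀ x, 0 ≤ E x) → ¬ G.IsPrincipal (ν - E) := by
  obtain ⟨n, ⟨κ⟩⟩ := Finite.exists_equiv_fin G.V
  set μ : G.V → ℤ := fun x =>
    (∑ e ∈ Finset.univ.filter (fun e : G.E => G.src e = x),
      if κ (G.tgt e) < κ (G.src e) then 1 else 0) +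
    (∑ e ∈ Finset.univ.filter (fun e : G.E => G.tgt e = x),
      if κ (G.src e) < κ (G.tgt e) then 1 else 0) - 1 with hμ
  refine ⟨Finsupp.equivFunOnFinite.symm μ, ?_, ?_⟩
  · rw [Finsupp.degree_eq_sum]
    simp only [Finsupp.equivFunOnFinite_symm_apply_apply, hμ]
    rw [Finset.sum_sub_distrib, Finset.sum_add_distrib, sum_sum_fiber, sum_sum_fiber,
      ← Finset.sum_add_distrib]
    have : ∀ e : G.E, ((if κ (G.tgt e) < κ (G.src e) then 1 else 0) +
        (if κ (G.src e) < κ (G.tgt e) then 1 else 0) : ℤ) = 1 := by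
      intro e
      have := κ.injective.ne (G.loopless e)
      rcases lt_or_gt_of_ne this with h | h <;> simp [h, h.not_gt]
    simp [this, ConnMultigraph.genus]
  · rintro E hE ⟨f, hf⟩
    -- Take the lowest-numbered minimizer of `f`: along every edge to a lower-numbered vertex `f`
    -- increases by at least `1`, so the Laplacian at `x` exceeds `ν x`.
    obtain ⟨x, -, hx⟩ := Finset.exists_min_image Finset.univ
      (fun x : G.V => toLex (f x, κ x)) (Finset.univ_nonempty_iff.2 G.nonempty)
    have hx' : ∀ y, f x ≤ f y ∧ (κ y < κ x → f x + 1 ≤ f y) := by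
      intro y
      have h1 : f x < f y ∨ f x = f y ∧ κ x ≤ κ y := by
        simpa [Prod.Lex.le_iff] using hx y (Finset.mem_univ y)
      constructor
      · omega
      · intro h2
        rcases h1 with h1 | h1
        · exact h1
        · exact absurd h1.2 (not_le.2 h2)
    have h2 : μ x + 1 ≤ G.laplacian f x := by
      simp only [hμ, sub_add_cancel]
      unfold laplacian
      refine add_le_add (Finset.sum_le_sum fun e he => ?_) (Finset.sum_le_sum fun e he => ?_)
      · rw [(Finset.mem_filter.1 he).2]
        have := hx' (G.tgt e)
        split_ifs with h
        · linarith [this.2 h]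
        · linarith [this.1]
      · rw [(Finset.mem_filter.1 he).2]
        have := hx' (G.src e)
        split_ifs with h
        · linarith [this.2 h]
        · linarith [this.1]
    have h3 := hf x
    simp only [Finsupp.coe_sub, Pi.sub_apply, Finsupp.equivFunOnFinite_symm_apply_apply] at h3
    linarith [hE x]

end FiniteGraph

/-! ### Metric graphs: principal divisors and a divisor without effective representative. -/

theorem HasRightSlope.sub {φ ψ : ℝ → ℝ} {t : ℝ} {s s' : ℤ} (h : HasRightSlope φ t s)
    (h' : HasRightSlope ψ t s') : HasRightSlope (fun x => φ x - ψ x) t (s - s') := by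
  unfold HasRightSlope at *
  filter_upwards [h, h'] with x hx hx'
  rw [hx, hx']; push_cast; ring

theorem HasLeftSlope.sub {φ ψ : ℝ → ℝ} {t : ℝ} {s s' : ℤ} (h : HasLeftSlope φ t s)
    (h' : HasLeftSlope ψ t s') : HasLeftSlope (fun x => φ x - ψ x) t (s - s') := by
  unfold HasLeftSlope at *
  filter_upwards [h, h'] with x hx hx'
  rw [hx, hx']; push_cast; ring

namespace MetricGraph

variable (Γ : MetricGraph.{u})

theorem param_zero (e : Γ.E) : Γ.param e 0 = Sum.inl (Γ.src e) := by
  simp [param]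

theorem param_len (e : Γ.E) : Γ.param e (Γ.len e) = Sum.inl (Γ.tgt e) := by
  simp [param, Γ.len_pos e]

theorem degree_eq_zero_of_isPrincipal {D : Γ.Point →₀ ℤ} (hD : Γ.IsPrincipal D) :
    D.degree = 0 := by
  obtain ⟨f, R, L, hf, hV, hE⟩ := hD
  let S : ∀ e : Γ.E, Finset (Set.Ioo (0 : ℝ) (Γ.len e)) := fun e =>
    D.support.preimage (fun t => Sum.inr ⟨e, t⟩) (fun a _ b _ hab => by simpa using hab)
  have hS : ∀ e t, t ∈ S e ↔ D (Sum.inr ⟨e, t⟩) ≠ 0 := fun e t =>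
    Finset.mem_preimage.trans Finsupp.mem_support_iff
  have hsub : D.support ⊆ Finset.univ.disjSum (Finset.univ.sigma S) := by
    rintro (x | ⟨e, t⟩) hx
    · simp
    · simpa [hS] using hx
  have hdeg : D.degree = ∑ x ∈ Finset.univ.disjSum (Finset.univ.sigma S), D x :=
    Finset.sum_subset hsub fun x _ hx => by simpa using hx
  rw [hdeg, Finset.sum_disjSum, Finset.sum_sigma]
  simp_rw [hV, hE]
  rw [Finset.sum_add_distrib]
  rw [sum_sum_fiber, sum_sum_fiber Γ.tgt fun e => L e (Γ.len e), ← Finset.sum_add_distrib, ← Finset.sum_add_distrib]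
  refine Finset.sum_eq_zero fun e _ =>
    sum_slopes_eq_zero (Γ.len_pos e) (hf.right e) (hf.left e) (S e) fun t ht => ?_
  rw [← hE]
  simpa [hS] using ht

theorem IsPrincipal.sub {D E : Γ.Point →₀ ℤ} (hD : Γ.IsPrincipal D) (hE : Γ.IsPrincipal E) :
    Γ.IsPrincipal (D - E) := by
  obtain ⟨f, R, L, hf, hV, hI⟩ := hD
  obtain ⟨f', R', L', hf', hV', hI'⟩ := hE
  refine ⟨fun x => f x - f' x, fun e t => R e t - R' e t, fun e t => L e t - L' e t,
    ⟨fun e t ht => (hf.right e t ht).sub (hf'.right e t ht),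
      fun e t ht => (hf.left e t ht).sub (hf'.left e t ht)⟩, fun x => ?_, fun e t => ?_⟩
  · rw [Finsupp.sub_apply, hV, hV', Finset.sum_sub_distrib, Finset.sum_sub_distrib]
    ring
  · rw [Finsupp.sub_apply, hI, hI']
    ring

/-- The divisor is the sum of the edge midpoints minus the sum of the vertices. A rational function
with divisor at most this one attains its minimum at a vertex by `min_endpoints_le`; the outgoing
slopes there are nonnegative, against the coefficient `-1`. -/
theorem exists_noneffective : ∃ ν : Γ.Point →₀ ℤ, ν.degree = Γ.toConnMultigraph.genus - 1 ∧
    ∀ E : Γ.Point →₀ ℤ, (∀ x, 0 ≤ E x) → ¬ Γ.IsPrincipal (ν - E) := by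
  have hmid : ∀ e, Γ.len e / 2 ∈ Set.Ioo (0 : ℝ) (Γ.len e) := fun e =>
    ⟨half_pos (Γ.len_pos e), half_lt_self (Γ.len_pos e)⟩
  set ν : Γ.Point →₀ ℤ := ∑ e, Finsupp.single (Sum.inr ⟨e, ⟨Γ.len e / 2, hmid e⟩⟩) 1 -
    ∑ x, Finsupp.single (Sum.inl x) 1 with hν
  have hνV : ∀ x, ν (Sum.inl x) = -1 := fun x => by
    simp [hν, Finsupp.single_apply]
  have hνE : ∀ e t, ν (Sum.inr ⟨e, t⟩) = if (t : ℝ) = Γ.len e / 2 then 1 else 0 := fun e t => by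
    simp only [hν, Finsupp.sub_apply, Finsupp.finsetSum_apply, Finsupp.single_apply, reduceCtorEq,
      if_false, Finset.sum_const_zero, sub_zero]
    rw [Finset.sum_eq_single e]
    · simp [Subtype.ext_iff, eq_comm]
    · intro e' _ he'
      simp [he']
    · simp
  refine ⟨ν, by simp [hν, map_sub, map_sum, ConnMultigraph.genus], ?_⟩
  rintro E hE ⟨f, R, L, hf, hV, hI⟩
  have := Γ.nonempty
  obtain ⟨x, hx⟩ := Finite.exists_min (fun x : Γ.V => f (Sum.inl x))
  have hmin : ∀ e, ∀ t ∈ Set.Icc 0 (Γ.len e), f (Sum.inl x) ≤ f (Γ.param e t) := by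
    intro e t ht
    refine le_trans ?_ (min_endpoints_le (hf.right e) (hf.left e) (Γ.len e / 2) ?_ ?_ ht)
    · rw [Γ.param_zero, Γ.param_len]
      exact le_min (hx _) (hx _)
    · intro t ht htc
      have h1 := hI e ⟨t, ht⟩
      rw [Finsupp.sub_apply, hνE, if_neg htc] at h1
      linarith [hE (Sum.inr ⟨e, ⟨t, ht⟩⟩)]
    · intro t ht
      have h1 := hI e ⟨t, ht⟩
      rw [Finsupp.sub_apply, hνE] at h1
      have h2 : (if t = Γ.len e / 2 then 1 else 0 : ℤ) ≤ 1 := by split_ifs <;> simp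
      have := hE (Sum.inr ⟨e, ⟨t, ht⟩⟩)
      simp only at h1
      linarith
  have h1 := hV x
  rw [Finsupp.sub_apply, hνV] at h1
  have h2 : 0 ≤ ∑ e ∈ Finset.univ.filter (fun e : Γ.E => Γ.src e = x), R e 0 := by
    refine Finset.sum_nonneg fun e he => ?_
    have hr := hf.right e 0 ⟨le_rfl, Γ.len_pos e⟩
    unfold HasRightSlope at hr
    obtain ⟨y, hy, h0y, hyl⟩ := (hr.and (eventually_mem_nhdsWithin.and
      ((eventually_lt_nhds (Γ.len_pos e)).filter_mono nhdsWithin_le_nhds))).exists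
    have h0y' : 0 < y := h0y
    have h3 := hmin e y ⟨h0y'.le, hyl.le⟩
    dsimp only at hy
    rw [hy, Γ.param_zero, (Finset.mem_filter.1 he).2] at h3
    have : (0 : ℝ) ≤ R e 0 := nonneg_of_mul_nonneg_left (by linarith) (sub_pos.2 h0y')
    exact_mod_cast this
  have h3 : 0 ≤ ∑ e ∈ Finset.univ.filter (fun e : Γ.E => Γ.tgt e = x), L e (Γ.len e) := by
    refine Finset.sum_nonneg fun e he => ?_
    have hr := hf.left e (Γ.len e) ⟨Γ.len_pos e, le_rfl⟩
    unfold HasLeftSlope at hr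
    obtain ⟨y, hy, h0y, hyl⟩ := (hr.and (eventually_mem_nhdsWithin.and
      ((eventually_gt_nhds (Γ.len_pos e)).filter_mono nhdsWithin_le_nhds))).exists
    have h0y' : y < Γ.len e := h0y
    have h3 := hmin e y ⟨hyl.le, h0y'.le⟩
    dsimp only at hy
    rw [hy, Γ.param_len, (Finset.mem_filter.1 he).2] at h3
    have : (0 : ℝ) ≤ L e (Γ.len e) := nonneg_of_mul_nonneg_left (by linarith) (sub_pos.2 h0y')
    exact_mod_cast this
  linarith [hE (Sum.inl x)]

end MetricGraph

/-! ### Degree, rank, and the Riemann–Roch bound. -/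

namespace ChipGraph

variable {Γ : ChipGraph.{u}}

theorem deg_eq_degree (D : Γ.Div) : deg D = D.degree := rfl

theorem deg_add (D E : Γ.Div) : deg (D + E) = deg D + deg E := map_add Finsupp.degree D E

theorem deg_sub (D E : Γ.Div) : deg (D - E) = deg D - deg E := map_sub Finsupp.degree D E

theorem deg_zsmul_pt (n : ℤ) (p : Γ.Point) : deg (n • pt p) = n := by
  simp [deg_eq_degree, pt]

theorem deg_twist (v w : Γ.Point) (D : Γ.Div) (a b : ℤ) :
    deg (twist v w D a b) = deg D + a - b := by
  rw [twist, deg_sub, deg_add, deg_zsmul_pt, deg_zsmul_pt]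

theorem IsEffective.deg_nonneg {D : Γ.Div} (hD : IsEffective D) : 0 ≤ deg D :=
  Finset.sum_nonneg fun p _ => hD p

theorem IsEffective.add {D E : Γ.Div} (hD : IsEffective D) (hE : IsEffective E) :
    IsEffective (D + E) := fun p => add_nonneg (hD p) (hE p)

theorem isEffective_zsmul_pt {n : ℤ} (hn : 0 ≤ n) (p : Γ.Point) : IsEffective (n • pt p) := by
  intro q
  simp only [pt, Finsupp.smul_apply, Finsupp.single_apply]
  split_ifs <;> simp [hn]

theorem IsPrincipal.deg_eq_zero {D : Γ.Div} (hD : Γ.IsPrincipal D) : deg D = 0 := by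
  cases Γ with
  | finite G => exact G.degree_eq_zero_of_isPrincipal hD
  | metric G => exact G.degree_eq_zero_of_isPrincipal hD

theorem IsPrincipal.sub {D E : Γ.Div} (hD : Γ.IsPrincipal D) (hE : Γ.IsPrincipal E) :
    Γ.IsPrincipal (D - E) := by
  cases Γ with
  | finite G =>
    obtain ⟨f, hf⟩ := hD
    obtain ⟨f', hf'⟩ := hE
    refine ⟨fun y => f y - f' y, fun x => ?_⟩
    rw [G.laplacian_sub, ← hf, ← hf']
    rfl
  | metric G => exact MetricGraph.IsPrincipal.sub G hD hE

variable (Γ) in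
theorem exists_noneffective : ∃ ν : Γ.Div, deg ν = Γ.genus - 1 ∧ ¬ HasEffective ν := by
  cases Γ with
  | finite G =>
    obtain ⟨ν, h1, h2⟩ := G.exists_noneffective
    exact ⟨ν, h1, fun ⟨E, hE, hE'⟩ => h2 E hE hE'⟩
  | metric G =>
    obtain ⟨ν, h1, h2⟩ := G.exists_noneffective
    exact ⟨ν, h1, fun ⟨E, hE, hE'⟩ => h2 E hE hE'⟩

theorem HasEffective.deg_nonneg {D : Γ.Div} (hD : HasEffective D) : 0 ≤ deg D := by
  obtain ⟨E, hE, h⟩ := hD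
  have := IsPrincipal.deg_eq_zero h
  rw [deg_sub] at this
  linarith [hE.deg_nonneg]

theorem HasEffective.of_sub {D E : Γ.Div} (hE : IsEffective E) (h : HasEffective (D - E)) :
    HasEffective D := by
  obtain ⟨F, hF, h⟩ := h
  refine ⟨E + F, hE.add hF, ?_⟩
  unfold LinEquiv at *
  rwa [← sub_sub]

theorem neg_one_mem_rank_set (D : Γ.Div) : (-1 : ℤ) ∈
    {k : ℤ | -1 ≤ k ∧ ∀ E : Γ.Div, IsEffective E → deg E = k → HasEffective (D - E)} :=
  ⟨le_rfl, fun E hE h => by linarith [hE.deg_nonneg]⟩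

theorem hasEffective_of_rank_nonneg (v : Γ.Point) {D : Γ.Div} (h : 0 ≤ rank D) :
    HasEffective D := by
  -- Boundedness is needed for the supremum defining the rank to be attained.
  have hb : BddAbove
      {k : ℤ | -1 ≤ k ∧ ∀ E : Γ.Div, IsEffective E → deg E = k → HasEffective (D - E)} := by
    refine ⟨max 0 (deg D), fun k hk => ?_⟩
    rcases le_or_gt k 0 with h0 | h0
    · exact h0.trans (le_max_left _ _)
    · have := (hk.2 _ (isEffective_zsmul_pt h0.le v) (deg_zsmul_pt k v)).deg_nonneg
      rw [deg_sub, deg_zsmul_pt] at this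
      exact le_max_of_le_right (by linarith)
  have hm := Int.csSup_mem ⟨_, neg_one_mem_rank_set D⟩ hb
  have hE := isEffective_zsmul_pt h v
  exact .of_sub hE (hm.2 _ hE (deg_zsmul_pt _ v))


/-- If `D` dominates a divisor of degree `g - 1` that has no effective representative, then its rank
is at most `deg D - g`. -/
theorem rank_le_of_hasEffective_sub (v : Γ.Point) {D ν : Γ.Div} (hν : ¬ HasEffective ν)
    (h : HasEffective (D - ν)) : rank D ≤ deg D - deg ν - 1 := by
  obtain ⟨F, hF, hP⟩ := h
  have hP' : Γ.IsPrincipal (D - ν - F) := hP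
  have hd := IsPrincipal.deg_eq_zero hP'
  rw [deg_sub, deg_sub] at hd
  refine csSup_le ⟨_, neg_one_mem_rank_set D⟩ fun k hk => ?_
  by_contra hlt
  have hk' : 0 ≤ k - deg F := by omega
  -- Here `D - ν ~ F`, so removing `F` from `D` leaves `ν` up to equivalence. Padding `F` with
  -- copies of `v` to degree `k ≥ deg F` would make `ν` equivalent to an effective divisor.
  obtain ⟨E, hE, hQ⟩ := hk.2 (F + (k - deg F) • pt v) (hF.add (isEffective_zsmul_pt hk' v))
    (by rw [deg_add, deg_zsmul_pt]; ring)
  refine hν ⟨(k - deg F) • pt v + E, (isEffective_zsmul_pt hk' v).add hE, ?_⟩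
  have := IsPrincipal.sub hQ hP'
  unfold LinEquiv
  convert this using 1
  abel

/-- Half of the Riemann-Roch theorem for divisors of large degree in a twist family. -/
theorem HasZeroGeneralTransmission.exists_rank_twist_le {v w : Γ.Point}
    (h : HasZeroGeneralTransmission v w) (D : Γ.Div) (b : ℤ) :
    ∃ a₀, ∀ a ≥ a₀, rank (twist v w D a b) ≤ deg D + a - b - Γ.genus := by
  obtain ⟨ν, hν, hν'⟩ := exists_noneffective Γ
  obtain ⟨-, τ, hτ, -⟩ := h (D - ν)
  -- For `a ≥ τ b` the set counted by the transmission permutation of `D - ν` contains `b`, so the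
  -- rank is nonnegative.
  refine ⟨τ b, fun a ha => ?_⟩
  have h1 : HasEffective (twist v w (D - ν) a b) := by
    refine hasEffective_of_rank_nonneg v ?_
    obtain ⟨hfin, heq⟩ := hτ a b
    have : 0 < {n : ℤ | b ≤ n ∧ τ n ≤ a}.ncard := (Set.ncard_pos hfin).2 ⟨b, le_rfl, ha⟩
    omega
  have h2 : twist v w (D - ν) a b = twist v w D a b - ν := by
    unfold twist; abel
  rw [h2] at h1
  have := rank_le_of_hasEffective_sub v hν' h1
  rw [deg_twist] at this
  linarith

end ChipGraph

/-! ### Counting vanishing orders and inversions. -/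

/-- The largest `a` such that at least `R - i` members of `T` are `≥ a`, summed over `i < R`, is the
sum of the nonnegative members of `T`, if there are `R` of these. -/
theorem sum_sSup_ncard_inter_Ici (T : Set ℤ) (hT : ∀ a, (T ∩ Set.Ici a).Finite) {R : ℕ}
    (hR : (T ∩ Set.Ici 0).ncard = R) :
    ∑ i ∈ Finset.range R, sSup {a : ℤ | (R : ℤ) - i ≤ (T ∩ Set.Ici a).ncard} =
      ∑ t ∈ (hT 0).toFinset, t := by
  have hcard : (hT 0).toFinset.card = R := by rw [← hR, Set.ncard_eq_toFinset_card _ (hT 0)]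
  set e := (hT 0).toFinset.orderEmbOfFin hcard with he
  have hmem : ∀ t ∈ T, 0 ≤ t → ∃ j, e j = t := fun t ht h0 => by
    have : t ∈ Set.range e := by
      rw [he, Finset.range_orderEmbOfFin]
      simp [ht, h0]
    exact this
  have heT : ∀ j, e j ∈ T ∧ 0 ≤ e j := fun j => by
    have := Finset.orderEmbOfFin_mem (hT 0).toFinset hcard j
    rwa [Set.Finite.mem_toFinset] at this
  rw [Finset.sum_range]
  -- With the nonnegative members of `T` listed increasingly by `e`, exactly `R - i` members of `T`
  -- are `≥ e i`, and fewer are `≥ a` for any `a > e i`.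
  have hS : ∀ i : Fin R, sSup {a : ℤ | (R : ℤ) - (i : ℕ) ≤ (T ∩ Set.Ici a).ncard} = e i := by
    intro i
    refine IsGreatest.csSup_eq ⟨?_, fun a ha => ?_⟩
    · have h1 : T ∩ Set.Ici (e i) = e '' (Finset.Ici i : Finset (Fin R)) := by
        ext t
        constructor
        · rintro ⟨ht, hi⟩
          obtain ⟨j, rfl⟩ := hmem t ht ((heT i).2.trans hi)
          exact ⟨j, by simpa using hi, rfl⟩
        · rintro ⟨j, hj, rfl⟩
          exact ⟨(heT j).1, by simpa using hj⟩
      rw [Set.mem_ofPred_eq, h1, Set.ncard_image_of_injective _ e.injective, Set.ncard_coe_finset,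
        Fin.card_Ici]
      omega
    · by_contra hlt
      have hlt' : e i < a := not_le.1 hlt
      have h1 : T ∩ Set.Ici a ⊆ e '' (Finset.Ioi i : Finset (Fin R)) := by
        rintro t ⟨ht, hi⟩
        have hi' : a ≤ t := hi
        obtain ⟨j, rfl⟩ := hmem t ht ((heT i).2.trans (hlt'.le.trans hi'))
        exact ⟨j, by simpa using hlt'.trans_le hi', rfl⟩
      have h2 := Set.ncard_le_ncard h1 (Set.toFinite _)
      rw [Set.ncard_image_of_injective _ e.injective, Set.ncard_coe_finset, Fin.card_Ioi] at h2
      rw [Set.mem_ofPred_eq] at ha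
      have := i.2
      omega
  simp_rw [hS]
  rw [← Finset.map_orderEmbOfFin_univ (hT 0).toFinset hcard, Finset.sum_map]
  rfl

/-- Of the `A - τ n + 1` positions with value in `[τ n, A]`, at most `c + A - n` are `≥ n`. Each
remaining one lies before `n` and has a larger value, which is an inversion; `A` cancels. -/
theorem le_card_inversions_snd_eq {τ : Equiv.Perm ℤ} (hI : (inversions τ).Finite) {c n A : ℤ}
    (hA : τ n ≤ A) (hfin : {m : ℤ | n ≤ m ∧ τ m ≤ A}.Finite)
    (hle : ({m : ℤ | n ≤ m ∧ τ m ≤ A}.ncard : ℤ) ≤ c + A - n) :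
    n - τ n - c + 1 ≤ (hI.toFinset.filter fun p => p.2 = n).card := by
  have hsub : (Finset.Icc (τ n) A).image τ.symm ⊆
      hfin.toFinset ∪ (hI.toFinset.filter fun p => p.2 = n).image Prod.fst := by
    intro m hm
    obtain ⟨x, hx, rfl⟩ := Finset.mem_image.1 hm
    rw [Finset.mem_Icc] at hx
    rw [Finset.mem_union]
    rcases le_or_gt n (τ.symm x) with h | h
    · left
      simp [h, hx.2]
    · right
      refine Finset.mem_image.2 ⟨(τ.symm x, n), ?_, rfl⟩
      have hne : τ n ≠ x := fun hnx => h.ne (by rw [← hnx, Equiv.symm_apply_apply])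
      simpa [inversions, h] using lt_of_le_of_ne hx.1 hne
  have h1 := (Finset.card_le_card hsub).trans (Finset.card_union_le _ _)
  rw [Finset.card_image_of_injective _ τ.symm.injective, Int.card_Icc,
    ← Set.ncard_eq_toFinset_card _ hfin] at h1
  have h2 : ((hI.toFinset.filter fun p => p.2 = n).image Prod.fst).card ≤
      (hI.toFinset.filter fun p => p.2 = n).card := Finset.card_image_le
  omega

theorem sum_le_ncard_inversions {τ : Equiv.Perm ℤ} (hI : (inversions τ).Finite)
    (hfin : ∀ a b : ℤ, {m : ℤ | b ≤ m ∧ τ m ≤ a}.Finite) {c : ℤ}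
    (hle : ∀ b : ℤ, ∃ a₀ : ℤ, ∀ a ≥ a₀, ({m : ℤ | b ≤ m ∧ τ m ≤ a}.ncard : ℤ) ≤ c + a - b)
    (S : Finset ℤ) : ∑ n ∈ S, (n - τ n - c + 1) ≤ (inversions τ).ncard := by
  rw [Set.ncard_eq_toFinset_card _ hI]
  calc ∑ n ∈ S, (n - τ n - c + 1)
      ≤ ∑ n ∈ S, ((hI.toFinset.filter fun p => p.2 = n).card : ℤ) := by
        refine Finset.sum_le_sum fun n _ => ?_
        obtain ⟨a₀, ha₀⟩ := hle n
        exact le_card_inversions_snd_eq hI (le_max_right a₀ (τ n)) (hfin _ _)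
          (ha₀ _ (le_max_left _ _))
    _ ≤ hI.toFinset.card := by
        rw [← Nat.cast_sum]
        rw [Finset.sum_card_fiberwise_eq_card_filter]
        exact_mod_cast Finset.card_filter_le _ _

/-! ### Vanishing sequences read off from the transmission permutation. -/

namespace ChipGraph

variable {Γ : ChipGraph.{u}} {v w : Γ.Point} {D : Γ.Div} {τ : Equiv.Perm ℤ}

theorem IsTransmissionPerm.ncard_eq_toNat (hτ : IsTransmissionPerm v w D τ) :
    {n : ℤ | 0 ≤ n ∧ τ n ≤ 0}.ncard = (rank D + 1).toNat := by
  have h := (hτ 0 0).2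
  simp only [twist, zero_smul, add_zero, sub_zero] at h
  omega

theorem IsTransmissionPerm.sum_vanishing_right (hτ : IsTransmissionPerm v w D τ) :
    ∑ i ∈ Finset.range (rank D + 1).toNat, vanishing D w i = ∑ n ∈ (hτ 0 0).1.toFinset, n := by
  have hset : ∀ b, {n | τ n ≤ 0} ∩ Set.Ici b = {n : ℤ | b ≤ n ∧ τ n ≤ 0} := fun b =>
    Set.ext fun n => and_comm
  have hR := hτ.ncard_eq_toNat
  -- The members `≥ b` of this set number `r(D - bw) + 1`, so the `b_i` are its nonnegative members.
  have key := sum_sSup_ncard_inter_Ici {n | τ n ≤ 0} (fun b => by rw [hset]; exact (hτ 0 b).1)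
    (R := (rank D + 1).toNat) (by rw [hset]; exact hR)
  simp only [hset] at key
  rw [← key]
  refine Finset.sum_congr rfl fun i _ => ?_
  unfold vanishing
  congr 1
  ext b
  have h0 := (hτ 0 0).2
  have hb := (hτ 0 b).2
  simp only [twist, zero_smul, add_zero, sub_zero] at h0 hb
  simp only [Set.mem_ofPred_eq]
  omega

theorem IsTransmissionPerm.sum_vanishing_left (hτ : IsTransmissionPerm v w D τ) :
    ∑ i ∈ Finset.range (rank D + 1).toNat, vanishing D v i =
      ∑ n ∈ (hτ 0 0).1.toFinset, -τ n := by
  have hinj : Function.Injective fun n => -τ n := neg_injective.comp τ.injective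
  have hset : ∀ a, {x | 0 ≤ τ.symm (-x)} ∩ Set.Ici a =
      (fun n => -τ n) '' {n : ℤ | 0 ≤ n ∧ τ n ≤ -a} := by
    intro a
    ext x
    constructor
    · rintro ⟨h1, h2⟩
      have h2' : a ≤ x := h2
      exact ⟨τ.symm (-x), ⟨h1, by simpa using h2'⟩, by simp⟩
    · rintro ⟨n, ⟨h1, h2⟩, rfl⟩
      exact ⟨by simpa using h1, by simpa using (by linarith : a ≤ -τ n)⟩
  have hfin : ∀ a, ({x | 0 ≤ τ.symm (-x)} ∩ Set.Ici a).Finite := fun a => by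
    rw [hset]; exact (hτ (-a) 0).1.image _
  have hR := hτ.ncard_eq_toNat
  -- This is the set of values `-τ n` with `n ≥ 0`; its members `≥ a` number `r(D - av) + 1`.
  have key := sum_sSup_ncard_inter_Ici {x | 0 ≤ τ.symm (-x)} hfin
    (R := (rank D + 1).toNat) (by rw [hset, Set.ncard_image_of_injective _ hinj, neg_zero]; exact hR)
  have himg : (hfin 0).toFinset = (hτ 0 0).1.toFinset.image fun n => -τ n := by
    ext x
    rw [Set.Finite.mem_toFinset, hset, neg_zero, Finset.mem_image]
    simp
  rw [himg, Finset.sum_image hinj.injOn] at key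
  rw [← key]
  refine Finset.sum_congr rfl fun i _ => ?_
  unfold vanishing
  congr 1
  ext a
  have h0 := (hτ 0 0).2
  have ha := (hτ (-a) 0).2
  simp only [twist, zero_smul, add_zero, sub_zero, neg_smul, ← sub_eq_add_neg] at h0 ha
  simp only [Set.mem_ofPred_eq, hset, Set.ncard_image_of_injective _ hinj]
  omega

end ChipGraph

theorem theoremB (Γ : ChipGraph.{u}) (v w : Γ.Point)
    (h : ChipGraph.HasZeroGeneralTransmission v w)
    (D : Γ.Div) (d r : ℤ) (hd : ChipGraph.deg D = d) (hr : ChipGraph.rank D = r) :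
    0 ≤ Γ.genus - (r + 1) * (Γ.genus - d + r)
        - ∑ i ∈ Finset.range (r + 1).toNat, (ChipGraph.vanishing D v i - (i : ℤ))
        - ∑ i ∈ Finset.range (r + 1).toNat, (ChipGraph.vanishing D w i - (i : ℤ)) := by
  subst hd hr
  obtain ⟨-, τ, hτ, hI, hg⟩ := h D
  have hsum := sum_le_ncard_inversions hI (fun a b => (hτ a b).1)
    -- The extra `1` comes from the cardinality being rank plus one.
    (c := ChipGraph.deg D - Γ.genus + 1) (fun b => by
      obtain ⟨a₀, ha₀⟩ := h.exists_rank_twist_le D b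
      refine ⟨a₀, fun a ha => ?_⟩
      have h1 := ha₀ a ha
      have h2 := (hτ a b).2
      linarith) (hτ 0 0).1.toFinset
  have hcard : ((hτ 0 0).1.toFinset.card : ℤ) = ChipGraph.rank D + 1 := by
    have h0 := (hτ 0 0).2
    simp only [ChipGraph.twist, zero_smul, add_zero, sub_zero] at h0
    exact (congrArg Nat.cast (Set.ncard_eq_toFinset_card _ (hτ 0 0).1).symm).trans h0.symm
  have hid : 2 * ∑ i ∈ Finset.range (ChipGraph.rank D + 1).toNat, (i : ℤ) =
      (ChipGraph.rank D + 1) * ChipGraph.rank D := by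
    have h1 : ((ChipGraph.rank D + 1).toNat : ℤ) = ChipGraph.rank D + 1 :=
      Int.toNat_of_nonneg (by omega)
    have h2 : ∀ n : ℕ, 2 * ∑ i ∈ Finset.range n, (i : ℤ) = n * (n - 1) := by
      intro n
      induction n with
      | zero => simp
      | succ n ih => rw [Finset.sum_range_succ, mul_add, ih]; push_cast; ring
    rw [h2, h1]; ring
  have hS : ∑ n ∈ (hτ 0 0).1.toFinset, (n - τ n - (ChipGraph.deg D - Γ.genus + 1) + 1) =
      ∑ n ∈ (hτ 0 0).1.toFinset, n + ∑ n ∈ (hτ 0 0).1.toFinset, -τ n -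
        (ChipGraph.rank D + 1) * (ChipGraph.deg D - Γ.genus) := by
    rw [← hcard, ← nsmul_eq_mul, ← Finset.sum_const, ← Finset.sum_add_distrib,
      ← Finset.sum_sub_distrib]
    exact Finset.sum_congr rfl fun n _ => by ring
  rw [Finset.sum_sub_distrib, Finset.sum_sub_distrib, hτ.sum_vanishing_left,
    hτ.sum_vanishing_right]
  linarith
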